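/- All graphs are finite, simple and connected. For a group $G\leqslant\mathrm{Aut}(\Gamma)$, the graph $\Gamma$ is called $G$-edge-primitive if $G$ acts primitively on the set $E\Gamma$ of edges of $\Gamma$; $G^{E\Gamma}$ denotes the permutation group induced on $E\Gamma$. A quasiprimitive permutation group on a finite set $\Omega$ is of type PA if it has a unique minimal normal subgroup $N$, where $N\cong T^k$ for some finite nonabelian simple group $T$ and some $k\geq 2$, and for each $\omega\in\Omega$ one can identify $N$ with $T^k$ so that the stabiliser $N_\omega$ is a subdirect product of $R^k$ for some subgroup $R$ with $1<R<T$. Let $\Gamma$ be a $G$-edge-primitive graph such that $G^{E\Gamma}$ is of type PA, with $N=\mathrm{soc}(G)\cong T^k$, where $T$ is a finite nonabelian simple group and $k\geq 2$. Let $e=\{v,w\}$ be an edge. Regard $G$ as a subgroup of $\mathrm{Aut}(T)\,\mathrm{wr}\,S_k$ with $N=T_1\times\cdots\times T_k=\mathrm{Inn}(T)^k$, let $G_1=N_G(T_1)=G\cap(\mathrm{Aut}(T)\times(\mathrm{Aut}(T)\,\mathrm{wr}\,S_{k-1}))$, and let $\pi_1:G_1\to\mathrm{Aut}(T)$ be the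 projection to the first coordinate. Let $B=\pi_1(G_1)$, $E=\pi_1(G_1\cap G_e)$ and $H=\pi_1(G_1\cap G_v)$ be the groups induced by $G$, by the edge stabiliser $G_e$ and by the vertex stabiliser $G_v$. Then there exists a $B$-edge-primitive graph having an edge with stabiliser $E$ in $B$, one of whose ends has stabiliser $H$ in $B$. -/

import Mathlib

/-- `N` is a minimal normal subgroup of `G`. -/
structure IsMinimalNormal {G : Type*} [Group G] (N : Subgroup G) : Prop where
  normal : N.Normal
  ne_bot : N ≠ ⊥
  minimal : ∀ M : Subgroup G, M.Normal → M ≤ N → M = ⊥ ∨ M = N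

/-- The socle of `G`: the subgroup generated by all minimal normal subgroups. -/
def socle (G : Type*) [Group G] : Subgroup G :=
  sSup {N : Subgroup G | IsMinimalNormal N}

/-- A permutation group `P` on `Ω` is quasiprimitive of type PA, with socle isomorphic to `T ^ k`:
it has a unique minimal normal subgroup `N`, there are `k ≥ 2` simple direct factors, and for each
point `ω` one can identify `N` with `T ^ k` so that `N_ω` is a subdirect product of `R ^ k`, for
some `1 < R < T` (the projection of `N_ω` to every coordinate is exactly `R`).
The group `T` is meant to be a finite nonabelian simple group. The condition `R ≠ 1` separates
type PA from the type TW, where `N` is regular. -/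
structure IsTypePA (T : Type*) [Group T] (k : ℕ) {Ω : Type*} (P : Subgroup (Equiv.Perm Ω)) :
    Prop where
  quasiprimitive : MulAction.IsQuasiPreprimitive P Ω
  two_le : 2 ≤ k
  socle_stabilizer : ∃ N : Subgroup P, IsMinimalNormal N ∧
    (∀ M : Subgroup P, IsMinimalNormal M → M = N) ∧
    ∀ ω : Ω, ∃ (f : N ≃* (Fin k → T)) (R : Subgroup T), R ≠ ⊥ ∧ R ≠ ⊤ ∧
      ∀ i : Fin k, ((MulAction.stabilizer N ω).map f.toMonoidHom).map
        (Pi.evalMonoidHom (fun _ : Fin k => T) i) = R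

/-- The wreath product `Aut(T) wr S_k`, as the semidirect product of `Aut(T) ^ k` by `S_k`
permuting the coordinates. -/
abbrev AutWreath (T : Type*) [Group T] (k : ℕ) : Type _ :=
  (Fin k → MulAut T) ⋊[mulAutArrow] Equiv.Perm (Fin k)

/-- The subgroup `Inn(T) ^ k` of `Aut(T) wr S_k`, that is, the copy of `T ^ k`. -/
def innBase (T : Type*) [Group T] (k : ℕ) : Subgroup (AutWreath T k) :=
  (Subgroup.pi Set.univ fun _ : Fin k => (MulAut.conj : T →* MulAut T).range).map
    SemidirectProduct.inl

/-- The elements of `Aut(T) wr S_k` which fix the coordinate `i`, that is, the subgroup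
`Aut(T) × (Aut(T) wr S_{k-1})`. For nontrivial centreless `T` this is the normaliser of the
`i`-th direct factor of `Inn(T) ^ k`. -/
def coordStab (T : Type*) [Group T] (k : ℕ) (i : Fin k) : Subgroup (AutWreath T k) where
  carrier := {x | x.right i = i}
  one_mem' := rfl
  mul_mem' := by
    intro a b ha hb
    change a.right (b.right i) = i
    rw [show b.right i = i from hb]
    exact ha
  inv_mem' := by
    intro a ha
    change a.right⁻¹ i = i
    rw [Equiv.Perm.inv_eq_iff_eq]
    exact Eq.symm ha

/-- The projection `π_i : Aut(T) × (Aut(T) wr S_{k-1}) → Aut(T)` to the coordinate `i`. -/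
def coordProj (T : Type*) [Group T] (k : ℕ) (i : Fin k) : coordStab T k i →* MulAut T where
  toFun x := x.1.left i
  map_one' := rfl
  map_mul' := by
    rintro ⟨a, ha⟩ ⟨b, hb⟩
    have ha' : a.right⁻¹ i = i := by
      rw [Equiv.Perm.inv_eq_iff_eq]
      exact ha.symm
    change a.left i * b.left (a.right⁻¹ i) = a.left i * b.left i
    rw [ha']

/-- The subgroup of `Aut(T)` induced by a subgroup `S` of `Aut(T) wr S_k` on the coordinate `i`:
the image under `π_i` of the subgroup of the elements of `S` that fix `i`. -/
def inducedGroup {T : Type*} [Group T] {k : ℕ} (i : Fin k) (S : Subgroup (AutWreath T k)) :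
    Subgroup (MulAut T) :=
  (S.subgroupOf (coordStab T k i)).map (coordProj T k i)

/-- The action of `Aut(Γ)` on the set of edges of `Γ`. -/
def edgeAction {V : Type*} (Γ : SimpleGraph V) : (Γ ≃g Γ) →* Equiv.Perm Γ.edgeSet where
  toFun f := f.mapEdgeSet
  map_one' := by
    ext ⟨e, he⟩
    induction e with
    | _ x y => rfl
  map_mul' := by
    intro f g
    ext ⟨e, he⟩
    induction e with
    | _ x y => rfl

/-- The permutation group induced on the set of edges of `Γ` by a group `G` of automorphisms. -/
def edgeGroup {V : Type*} (Γ : SimpleGraph V) (G : Subgroup (Γ ≃g Γ)) :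
    Subgroup (Equiv.Perm Γ.edgeSet) :=
  G.map (edgeAction Γ)

/-- `Γ` is `G`-edge-primitive: `G` acts primitively on the set of edges. -/
def IsEdgePrimitive {V : Type*} (Γ : SimpleGraph V) (G : Subgroup (Γ ≃g Γ)) : Prop :=
  MulAction.IsPreprimitive (edgeGroup Γ G) Γ.edgeSet

/-- The stabiliser in `Aut(Γ)` of the vertex `v`. -/
def vertexStab {V : Type*} (Γ : SimpleGraph V) (v : V) : Subgroup (Γ ≃g Γ) where
  carrier := {f | f v = v}
  one_mem' := rfl
  mul_mem' := by
    intro f g hf hg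
    change f (g v) = v
    rw [show g v = v from hg]
    exact hf
  inv_mem' := by
    intro f hf
    change f.symm v = v
    conv_lhs => rw [← show f v = v from hf]
    exact f.symm_apply_apply v

/-- The setwise stabiliser in `Aut(Γ)` of the edge `e`. -/
def edgeStab {V : Type*} (Γ : SimpleGraph V) (e : Γ.edgeSet) : Subgroup (Γ ≃g Γ) :=
  (MulAction.stabilizer (Equiv.Perm Γ.edgeSet) e).comap (edgeAction Γ)

/-! ### Normal subgroups and homomorphisms of simple groups and their powers -/

namespace MulAut

variable {T : Type*} [Group T]

/-! Write `N` for Inn(T)^k and `Ge`, `Gv` for the edge and vertex stabilisers, all inside Aut(T) wr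
S_k. Edge-primitivity makes `Ge` maximal in `G`, and type PA makes the projection of `Ge ∩ N` to the
coordinate `i` a proper nontrivial subgroup of Inn(T). Hence G = N·Ge, and since `N` fixes every
coordinate, `Ge` and `G` have the same orbits on coordinates.

The heart is that `E` is maximal in `B` (`eq_or_eq_of_le`). Given E ≤ L ≤ B, the elements of `G`
whose products a·g·b with a, b in `Ge` project into `L` whenever they fix `i` form a subgroup
(`transportSubgroup`) between `Ge` and `G`. If it is `G`, then L = B. If it is `Ge`, then L ∩
Inn(T), placed in the `i`-th factor, lies in `Ge`, and G = N·Ge forces L = E. Moreover `E` does not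
contain Inn(T), so it is core-free in `B`.

If E ≤ H, then `H` is `E` or `B`, and a star with leaves B/E is the required graph. Otherwise some s
in `Ge` fixes `i` and swaps `v` and `w`, E ∩ H has index 2 in `E`, and the graph on B/H with edges
the translates of {H, cH}, c in E \ H, works. Faithfulness needs that `H` does not contain Inn(T)
(`not_range_conj_le_vertex`), and connectedness that H is not inside `E` (`not_induced_le`). Both
are deduced by means of s. -/

theorem mul_conj_mul_inv (σ : MulAut T) (t : T) : σ * conj t * σ⁻¹ = conj (σ t) := by
  ext x
  simp

theorem conj_eq_one_of_simple [IsSimpleGroup T] (hT : ∃ a b : T, a * b ≠ b * a) {t : T}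
    (ht : conj t = 1) : t = 1 := by
  have hc : t ∈ Subgroup.center T := by
    rw [Subgroup.mem_center_iff]
    intro g
    have h := DFunLike.congr_fun ht g
    simp only [conj_apply, one_apply] at h
    exact (mul_inv_eq_iff_eq_mul.1 h).symm
  rcases (inferInstance : (Subgroup.center T).Normal).eq_bot_or_eq_top with h | h
  · rw [h] at hc
    exact hc
  · obtain ⟨a, b, hab⟩ := hT
    have : b ∈ Subgroup.center T := by rw [h]; trivial
    exact absurd (Subgroup.mem_center_iff.1 this a) hab

/-- A subgroup of `Aut(T)` normalised by `Inn(T)` that does not contain `Inn(T)` is trivial. -/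
theorem eq_one_of_normalized [IsSimpleGroup T]
    (K : Subgroup (MulAut T)) (hn : ∀ t : T, ∀ x ∈ K, conj t * x * (conj t)⁻¹ ∈ K)
    (hK : ¬ (conj : T →* MulAut T).range ≤ K) {x : MulAut T} (hx : x ∈ K) : x = 1 := by
  have hnorm : (K.comap (conj : T →* MulAut T)).Normal :=
    ⟨fun a ha t => by
      have := hn t _ ha
      rwa [← map_inv, ← map_mul, ← map_mul] at this⟩
  rcases hnorm.eq_bot_or_eq_top with h | h
  · ext t
    -- The commutator of `conj t` and `x` lies in `K` and equals `conj (t * (x t)⁻¹)`; a trivial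
    -- preimage therefore forces `x` to fix every `t`.
    have h1 : t * (x t)⁻¹ ∈ K.comap (conj : T →* MulAut T) := by
      rw [Subgroup.mem_comap, map_mul, map_inv, ← mul_conj_mul_inv]
      have := K.mul_mem (hn t x hx) (K.inv_mem hx)
      simpa [mul_assoc] using this
    rw [h, Subgroup.mem_bot, mul_inv_eq_one] at h1
    simpa using h1.symm
  · exact absurd (by rw [MonoidHom.range_eq_map, Subgroup.map_le_iff_le_comap, h]) hK

end MulAut

/-- A surjective homomorphism from a power of a simple group to a nonabelian simple group factors
through a coordinate. -/
theorem MonoidHom.exists_eq_comp_eval {ι T Q : Type*} [Finite ι] [DecidableEq ι] [Group T]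
    [Group Q] [IsSimpleGroup T] [IsSimpleGroup Q] (hQ : ∃ a b : Q, a * b ≠ b * a)
    (p : (ι → T) →* Q) (hp : Function.Surjective p) :
    ∃ (j : ι) (θ : T →* Q), Function.Injective θ ∧ Function.Surjective θ ∧
      ∀ x, p x = θ (x j) := by
  have hex : ∃ j : ι, ∃ t : T, p (Pi.mulSingle j t) ≠ 1 := by
    by_contra! hcon
    have : p = 1 := MonoidHom.pi_ext fun i x => by simp [hcon]
    obtain ⟨q, hq⟩ := exists_ne (1 : Q)
    obtain ⟨x, rfl⟩ := hp q
    exact hq (by rw [this]; rfl)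
  obtain ⟨j, t, ht⟩ := hex
  let θ : T →* Q := p.comp (MonoidHom.mulSingle (fun _ => T) j)
  have hinj : Function.Injective θ := by
    rcases (inferInstance : θ.ker.Normal).eq_bot_or_eq_top with h | h
    · exact (MonoidHom.ker_eq_bot_iff θ).1 h
    · have : t ∈ θ.ker := by rw [h]; trivial
      exact absurd this ht
  have hrange : θ.range.Normal := by
    refine ⟨?_⟩
    rintro _ ⟨a, rfl⟩ q
    obtain ⟨x, rfl⟩ := hp q
    -- Conjugating an element of the `j`-th factor by `x` involves only `x j`.
    refine ⟨x j * a * (x j)⁻¹, ?_⟩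
    simp only [θ, MonoidHom.comp_apply, MonoidHom.mulSingle_apply, ← map_mul, ← map_inv]
    congr 1
    funext l
    by_cases hl : l = j
    · subst hl; simp
    · simp [hl]
  have hsurj : Function.Surjective θ := by
    rcases hrange.eq_bot_or_eq_top with h | h
    · have : θ t ∈ θ.range := ⟨t, rfl⟩
      rw [h] at this
      exact absurd this ht
    · exact MonoidHom.range_eq_top.1 h
  have hoff : ∀ l ≠ j, ∀ a, p (Pi.mulSingle l a) = 1 := by
    intro l hl a
    -- Different factors commute and the `j`-th one already maps onto `Q`, so the others map into
    -- the centre of `Q`.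
    have hc : p (Pi.mulSingle l a) ∈ Subgroup.center Q := by
      rw [Subgroup.mem_center_iff]
      intro q
      obtain ⟨b, rfl⟩ := hsurj q
      have := (Pi.mulSingle_commute hl (f := fun _ => T) a b).symm.map p
      exact this
    rcases (inferInstance : (Subgroup.center Q).Normal).eq_bot_or_eq_top with h | h
    · rw [h] at hc
      exact hc
    · obtain ⟨c, d, hcd⟩ := hQ
      have : d ∈ Subgroup.center Q := by rw [h]; trivial
      exact absurd (Subgroup.mem_center_iff.1 this c) hcd
  refine ⟨j, θ, hinj, hsurj, fun x => ?_⟩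
  have : p = θ.comp (Pi.evalMonoidHom (fun _ => T) j) := MonoidHom.pi_ext fun l a => by
    by_cases hl : l = j
    · subst hl; simp [θ]
    · simp [hoff l hl, Pi.mulSingle_eq_of_ne (Ne.symm hl)]
  rw [this]
  rfl

/-! ### Coordinates in Aut(T) wr S_k -/

namespace AutWreath

variable {T : Type*} [Group T] {k : ℕ} {i : Fin k}

theorem left_mul_of_right_apply {a b : AutWreath T k} (ha : a.right i = i) :
    (a * b).left i = a.left i * b.left i := by
  have ha' : a.right⁻¹ i = i := by
    rw [Equiv.Perm.inv_eq_iff_eq]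
    exact ha.symm
  change a.left i * b.left (a.right⁻¹ i) = _
  rw [ha']

theorem right_mul_apply {a b : AutWreath T k} (j : Fin k) :
    (a * b).right j = a.right (b.right j) := rfl

theorem right_inv_apply_of_right_apply {a : AutWreath T k} (ha : a.right i = i) :
    (a⁻¹).right i = i := by
  change a.right⁻¹ i = i
  rw [Equiv.Perm.inv_eq_iff_eq]
  exact ha.symm

theorem left_inv_of_right_apply {a : AutWreath T k} (ha : a.right i = i) :
    (a⁻¹).left i = (a.left i)⁻¹ := by
  have := left_mul_of_right_apply (b := a⁻¹) ha
  rw [mul_inv_cancel] at this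
  exact eq_inv_of_mul_eq_one_right this.symm

theorem mem_inducedGroup {S : Subgroup (AutWreath T k)} {b : MulAut T} :
    b ∈ inducedGroup i S ↔ ∃ g ∈ S, g.right i = i ∧ g.left i = b := by
  constructor
  · rintro ⟨⟨g, hg⟩, hgS, rfl⟩
    exact ⟨g, hgS, hg, rfl⟩
  · rintro ⟨g, hgS, hg, rfl⟩
    exact ⟨⟨g, hg⟩, hgS, rfl⟩

theorem mem_innBase {x : AutWreath T k} :
    x ∈ innBase T k ↔ x.right = 1 ∧ ∀ j, ∃ t, MulAut.conj t = x.left j := by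
  constructor
  · rintro ⟨y, hy, rfl⟩
    exact ⟨rfl, fun j => hy j trivial⟩
  · rintro ⟨h1, h2⟩
    exact ⟨x.left, fun j _ => h2 j, SemidirectProduct.ext rfl h1.symm⟩

instance innBase_normal : (innBase T k).Normal := by
  refine ⟨fun n hn g => ?_⟩
  rw [mem_innBase] at hn ⊢
  refine ⟨by simp [hn.1], fun j => ?_⟩
  obtain ⟨t, ht⟩ := hn.2 (g.right⁻¹ j)
  refine ⟨g.left j t, ?_⟩
  have h := hn.1
  change _ = g.left j * n.left (g.right⁻¹ j) * (g⁻¹).left ((g.right * n.right)⁻¹ j)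
  have hg : g.left j * (g⁻¹).left (g.right⁻¹ j) = 1 := by
    change (g * g⁻¹).left j = 1
    rw [mul_inv_cancel]
    rfl
  rw [h, mul_one, ← ht, ← MulAut.mul_conj_mul_inv, eq_inv_of_mul_eq_one_right hg]

/-- The element `conj t` of the `i`-th factor of `Inn(T) ^ k`. -/
def innSingle (i : Fin k) (t : T) : AutWreath T k :=
  SemidirectProduct.inl (Pi.mulSingle i (MulAut.conj t))

theorem innSingle_mem (t : T) : innSingle i t ∈ innBase T k := by
  rw [mem_innBase]
  refine ⟨rfl, fun j => ?_⟩
  by_cases h : j = i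
  · subst h
    exact ⟨t, by simp [innSingle]⟩
  · exact ⟨1, by simp [innSingle, h]⟩

theorem innSingle_left (t : T) : (innSingle i t : AutWreath T k).left i = MulAut.conj t := by
  simp [innSingle]

theorem innSingle_left_ne (t : T) {j : Fin k} (hj : j ≠ i) :
    (innSingle i t : AutWreath T k).left j = 1 := by
  simp [innSingle, hj]

theorem conj_innSingle (t : T) {g : AutWreath T k} (hg : g.right i = i) :
    g * innSingle i t * g⁻¹ = innSingle i (g.left i t) := by
  rw [mul_inv_eq_iff_eq_mul]
  apply SemidirectProduct.ext
  · funext j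
    change g.left j * (innSingle i t : AutWreath T k).left (g.right⁻¹ j)
      = (innSingle i (g.left i t) : AutWreath T k).left j * g.left j
    by_cases hj : j = i
    · subst hj
      have : g.right⁻¹ j = j := right_inv_apply_of_right_apply hg
      rw [this, innSingle_left, innSingle_left, ← MulAut.mul_conj_mul_inv]
      group
    · have : g.right⁻¹ j ≠ i := by
        rw [Ne, Equiv.Perm.inv_eq_iff_eq, hg]
        exact hj
      rw [innSingle_left_ne _ this, innSingle_left_ne _ hj]
      simp
  · rfl

end AutWreath

/-! ### The transport subgroup and the groups induced on one coordinate -/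

namespace AutWreath

variable {T : Type*} [Group T] {k : ℕ} {i : Fin k}

theorem inducedGroup_mono {S S' : Subgroup (AutWreath T k)} (h : S ≤ S') :
    inducedGroup i S ≤ inducedGroup i S' := by
  intro b hb
  rw [mem_inducedGroup] at hb ⊢
  obtain ⟨g, hg, h1⟩ := hb
  exact ⟨g, h hg, h1⟩

/-- For a group `Ge` with the same orbit of the coordinate `i` as `G` and a subgroup `L` containing
the group induced by `Ge`, the elements of `G` all of whose `Ge`-transports into the coordinate `i`
lie in `L`. -/
def transportSubgroup {G Ge : Subgroup (AutWreath T k)} (hle : Ge ≤ G)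
    (horb : ∀ g ∈ G, ∃ c ∈ Ge, (g * c).right i = i) (L : Subgroup (MulAut T))
    (hL : inducedGroup i Ge ≤ L) : Subgroup (AutWreath T k) where
  carrier := {g | g ∈ G ∧ ∀ a ∈ Ge, ∀ b ∈ Ge, (a * g * b).right i = i → (a * g * b).left i ∈ L}
  one_mem' := ⟨G.one_mem, fun a ha b hb h =>
    hL (mem_inducedGroup.2 ⟨a * 1 * b, by simpa using Ge.mul_mem ha hb, h, rfl⟩)⟩
  mul_mem' := by
    rintro g h ⟨hg, hg'⟩ ⟨hh, hh'⟩
    refine ⟨G.mul_mem hg hh, fun a ha b hb hab => ?_⟩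
    -- Inserting `c * c⁻¹` between `g` and `h` splits the product into two transports that both fix
    -- `i`.
    obtain ⟨c, hc, hfix⟩ := horb (a * g) (G.mul_mem (hle ha) hg)
    have heq : a * (g * h) * b = (a * g * c) * (c⁻¹ * h * b) := by group
    have hfix' : (c⁻¹ * h * b).right i = i := by
      have : c⁻¹ * h * b = (a * g * c)⁻¹ * (a * (g * h) * b) := by group
      rw [this, right_mul_apply, hab]
      exact right_inv_apply_of_right_apply hfix
    rw [heq, left_mul_of_right_apply hfix]
    exact L.mul_mem (hg' a ha c hc hfix) (hh' _ (Ge.inv_mem hc) b hb hfix')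
  inv_mem' := by
    rintro g ⟨hg, hg'⟩
    refine ⟨G.inv_mem hg, fun a ha b hb hab => ?_⟩
    have heq : b⁻¹ * g * a⁻¹ = (a * g⁻¹ * b)⁻¹ := by group
    have h := hg' _ (Ge.inv_mem hb) _ (Ge.inv_mem ha)
      (by rw [heq]; exact right_inv_apply_of_right_apply hab)
    rw [heq, left_inv_of_right_apply hab] at h
    simpa using L.inv_mem h

variable {G Ge : Subgroup (AutWreath T k)}

theorem le_transportSubgroup (hle : Ge ≤ G)
    (horb : ∀ g ∈ G, ∃ c ∈ Ge, (g * c).right i = i) (L : Subgroup (MulAut T))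
    (hL : inducedGroup i Ge ≤ L) : Ge ≤ transportSubgroup hle horb L hL :=
  fun g hg => ⟨hle hg, fun a ha b hb h =>
    hL (mem_inducedGroup.2 ⟨a * g * b, Ge.mul_mem (Ge.mul_mem ha hg) hb, h, rfl⟩)⟩

/-- A transport a·n·b of an element of the `i`-th factor sees that factor only when `b` fixes `i`;
otherwise its `i`-th coordinate is that of a·b, which is in `Ge`. -/
theorem innSingle_mem_transportSubgroup (hN : innBase T k ≤ G) (hle : Ge ≤ G)
    (horb : ∀ g ∈ G, ∃ c ∈ Ge, (g * c).right i = i) (L : Subgroup (MulAut T))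
    (hL : inducedGroup i Ge ≤ L) {t : T} (ht : MulAut.conj t ∈ L) :
    innSingle i t ∈ transportSubgroup hle horb L hL := by
  refine ⟨hN (innSingle_mem t), fun a ha b hb hab => ?_⟩
  have hab' : a.right (b.right i) = i := hab
  by_cases hbi : b.right i = i
  · have hai : a.right i = i := by rwa [hbi] at hab'
    rw [mul_assoc, left_mul_of_right_apply hai,
      left_mul_of_right_apply (a := innSingle i t) (b := b) rfl, innSingle_left]
    exact L.mul_mem (hL (mem_inducedGroup.2 ⟨a, ha, hai, rfl⟩))
      (L.mul_mem ht (hL (mem_inducedGroup.2 ⟨b, hb, hbi, rfl⟩)))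
  · have hai : a.right⁻¹ i = b.right i := by
      rw [Equiv.Perm.inv_eq_iff_eq]
      exact hab'.symm
    have : (a * innSingle i t * b).left i = (a * b).left i := by
      change a.left i * (innSingle i t : AutWreath T k).left (a.right⁻¹ i)
        * b.left ((a.right * 1)⁻¹ i) = a.left i * b.left (a.right⁻¹ i)
      rw [innSingle_left_ne t (by rw [hai]; exact hbi), mul_one, mul_one]
    rw [this]
    exact hL (mem_inducedGroup.2 ⟨a * b, Ge.mul_mem ha hb, hab, rfl⟩)

/-- The configuration of a maximal subgroup `Ge` of a group `G` between `Inn(T) ^ k` and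
`Aut(T) wr S_k`, where the projection of `Ge ∩ Inn(T) ^ k` to the coordinate `i` is a proper
nontrivial subgroup of `Inn(T)`. -/
structure IsPAStabilizer (i : Fin k) (G Ge : Subgroup (AutWreath T k)) : Prop where
  innBase_le : innBase T k ≤ G
  le : Ge ≤ G
  maximal : ∀ X : Subgroup (AutWreath T k), Ge ≤ X → X ≤ G → X = Ge ∨ X = G
  ne_one : ∃ n ∈ innBase T k, n ∈ Ge ∧ n.left i ≠ 1
  ne_conj : ∃ t : T, ∀ n ∈ innBase T k, n ∈ Ge → n.left i ≠ MulAut.conj t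

namespace IsPAStabilizer

/-- The factorisation G = N·Ge: `Ge` is maximal and does not contain `N`. -/
theorem exists_mul (h : IsPAStabilizer i G Ge) {g : AutWreath T k} (hg : g ∈ G) :
    ∃ n ∈ innBase T k, ∃ c ∈ Ge, n * c = g := by
  rcases h.maximal (innBase T k ⊔ Ge) le_sup_right (sup_le h.innBase_le h.le) with h1 | h1
  · obtain ⟨t, ht⟩ := h.ne_conj
    exact absurd (innSingle_left t) (ht (innSingle i t) (innSingle_mem t)
      (h1 ▸ (le_sup_left : innBase T k ≤ _) (innSingle_mem t)))
  · rw [← h1, Subgroup.mem_sup_of_normal_left] at hg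
    exact hg

theorem exists_right_apply (h : IsPAStabilizer i G Ge) {g : AutWreath T k} (hg : g ∈ G) :
    ∃ c ∈ Ge, (g * c).right i = i := by
  obtain ⟨n, hn, c, hc, rfl⟩ := h.exists_mul hg
  refine ⟨c⁻¹, Ge.inv_mem hc, ?_⟩
  rw [mul_inv_cancel_right, (mem_innBase.1 hn).1]
  rfl

theorem range_conj_le (h : IsPAStabilizer i G Ge) :
    (MulAut.conj : T →* MulAut T).range ≤ inducedGroup i G := by
  rintro _ ⟨t, rfl⟩
  exact mem_inducedGroup.2 ⟨innSingle i t, h.innBase_le (innSingle_mem t), rfl, innSingle_left t⟩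

/-- The projection of `Ge ∩ N` is normalised by the group induced by `Ge`. If that group contained
Inn(T), the projection would be trivial or contain Inn(T), and type PA excludes both. -/
theorem not_range_conj_le [IsSimpleGroup T] (h : IsPAStabilizer i G Ge) :
    ¬ (MulAut.conj : T →* MulAut T).range ≤ inducedGroup i Ge := by
  intro hle
  obtain ⟨n, hn, hne, h1⟩ := h.ne_one
  refine h1 (MulAut.eq_one_of_normalized (inducedGroup i (innBase T k ⊓ Ge)) ?_ ?_
    (mem_inducedGroup.2 ⟨n, ⟨hn, hne⟩, by rw [(mem_innBase.1 hn).1]; rfl, rfl⟩))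
  · intro t x hx
    obtain ⟨g, hg, hgi, hgt⟩ := mem_inducedGroup.1 (hle ⟨t, rfl⟩)
    obtain ⟨m, ⟨hm, hme⟩, hmi, rfl⟩ := mem_inducedGroup.1 hx
    rw [← hgt]
    have hgm : (g * m).right i = i := by rw [right_mul_apply, hmi, hgi]
    refine mem_inducedGroup.2 ⟨g * m * g⁻¹, ⟨innBase_normal.conj_mem m hm g,
      Ge.mul_mem (Ge.mul_mem hg hme) (Ge.inv_mem hg)⟩, ?_, ?_⟩
    · rw [right_mul_apply, right_inv_apply_of_right_apply hgi, hgm]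
    · rw [left_mul_of_right_apply hgm, left_mul_of_right_apply hgi, left_inv_of_right_apply hgi]
  · intro hall
    obtain ⟨t, ht⟩ := h.ne_conj
    obtain ⟨m, ⟨hm, hme⟩, -, hmt⟩ := mem_inducedGroup.1 (hall ⟨t, rfl⟩)
    exact ht m hm hme hmt

/-- Either all transports of `G` lie in `L`, or only those of `Ge` do. -/
theorem transportSubgroup_eq (h : IsPAStabilizer i G Ge) (L : Subgroup (MulAut T))
    (hL : inducedGroup i Ge ≤ L) :
    transportSubgroup h.le (fun _ hg => h.exists_right_apply hg) L hL = Ge ∨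
      inducedGroup i G ≤ L := by
  rcases h.maximal _ (le_transportSubgroup h.le (fun _ hg => h.exists_right_apply hg) L hL)
    (fun g hg => hg.1) with h1 | h1
  · exact Or.inl h1
  · refine Or.inr fun b hb => ?_
    obtain ⟨g, hg, hgi, rfl⟩ := mem_inducedGroup.1 hb
    rw [← h1] at hg
    simpa using hg.2 1 Ge.one_mem 1 Ge.one_mem (by simpa using hgi)

/-- The group induced by the maximal subgroup `Ge` is maximal in the group induced by `G`. -/
theorem eq_or_eq_of_le (h : IsPAStabilizer i G Ge) (L : Subgroup (MulAut T))
    (hL : inducedGroup i Ge ≤ L) (hL' : L ≤ inducedGroup i G) :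
    L = inducedGroup i Ge ∨ L = inducedGroup i G := by
  rcases h.transportSubgroup_eq L hL with h1 | h1
  · refine Or.inl (le_antisymm (fun b hb => ?_) hL)
    obtain ⟨g, hg, hgi, rfl⟩ := mem_inducedGroup.1 (hL' hb)
    obtain ⟨n, hn, c, hc, rfl⟩ := h.exists_mul hg
    have hni : n.right i = i := by rw [(mem_innBase.1 hn).1]; rfl
    have hci : c.right i = i := by rwa [right_mul_apply, (mem_innBase.1 hn).1] at hgi
    have hcE : c.left i ∈ inducedGroup i Ge := mem_inducedGroup.2 ⟨c, hc, hci, rfl⟩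
    rw [left_mul_of_right_apply hni] at hb ⊢
    refine Subgroup.mul_mem _ ?_ hcE
    obtain ⟨t, ht⟩ := (mem_innBase.1 hn).2 i
    have htL : MulAut.conj t ∈ L := by
      rw [ht]
      exact (L.mul_mem_cancel_right (hL hcE)).1 hb
    have := innSingle_mem_transportSubgroup h.innBase_le h.le
      (fun _ hg => h.exists_right_apply hg) L hL htL
    rw [h1] at this
    exact mem_inducedGroup.2 ⟨_, this, rfl, by rw [innSingle_left, ht]⟩
  · exact Or.inr (le_antisymm hL' h1)

theorem transportSubgroup_self [IsSimpleGroup T] (h : IsPAStabilizer i G Ge) :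
    transportSubgroup h.le (fun _ hg => h.exists_right_apply hg) (inducedGroup i Ge) le_rfl
      = Ge :=
  (h.transportSubgroup_eq _ le_rfl).resolve_right
    fun h1 => h.not_range_conj_le (h.range_conj_le.trans h1)

/-- Knowing only that `conj t` is induced by some element of `Ge`, one may choose that element
inside the `i`-th factor. -/
theorem innSingle_mem [IsSimpleGroup T] (h : IsPAStabilizer i G Ge) {t : T}
    (ht : MulAut.conj t ∈ inducedGroup i Ge) : innSingle i t ∈ Ge := by
  have := innSingle_mem_transportSubgroup h.innBase_le h.le
    (fun _ hg => h.exists_right_apply hg) _ le_rfl ht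
  rwa [h.transportSubgroup_self] at this

variable {Gv : Subgroup (AutWreath T k)}

theorem exists_fix_not_mem (hE : ¬ inducedGroup i Ge ≤ inducedGroup i Gv) :
    ∃ s ∈ Ge, s ∉ Gv ∧ s.right i = i ∧ s.left i ∉ inducedGroup i Gv := by
  obtain ⟨b, hb, hbv⟩ := SetLike.not_le_iff_exists.1 hE
  obtain ⟨s, hs, hsi, rfl⟩ := mem_inducedGroup.1 hb
  exact ⟨s, hs, fun hv => hbv (mem_inducedGroup.2 ⟨s, hv, hsi, rfl⟩), hsi, hbv⟩

theorem mul_mem_of_not_mem (hidx : ∀ a ∈ Ge, ∀ b ∈ Ge, a ∉ Gv → b ∉ Gv → a * b ∈ Gv)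
    {a b : MulAut T} (ha : a ∈ inducedGroup i Ge) (hb : b ∈ inducedGroup i Ge)
    (hav : a ∉ inducedGroup i Gv) (hbv : b ∉ inducedGroup i Gv) :
    a * b ∈ inducedGroup i Gv := by
  obtain ⟨s, hs, hsi, rfl⟩ := mem_inducedGroup.1 ha
  obtain ⟨r, hr, hri, rfl⟩ := mem_inducedGroup.1 hb
  refine mem_inducedGroup.2 ⟨s * r, hidx s hs r hr ?_ ?_, by rw [right_mul_apply, hri, hsi],
    left_mul_of_right_apply hsi⟩
  · exact fun h => hav (mem_inducedGroup.2 ⟨s, h, hsi, rfl⟩)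
  · exact fun h => hbv (mem_inducedGroup.2 ⟨r, h, hri, rfl⟩)

/-- If the edge group does not induce a subgroup of what the vertex group induces, then the vertex
group does not induce a subgroup of what the edge group induces either. -/
theorem not_induced_le [IsSimpleGroup T] (h : IsPAStabilizer i G Ge) (hv : Gv ≤ G)
    (hidx : ∀ a ∈ Ge, ∀ b ∈ Ge, a ∉ Gv → b ∉ Gv → a * b ∈ Gv)
    (hnl : ∀ s ∈ Ge, s ∉ Gv → ¬ Gv ≤ Ge)
    (hE : ¬ inducedGroup i Ge ≤ inducedGroup i Gv) :
    ¬ inducedGroup i Gv ≤ inducedGroup i Ge := by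
  intro hle
  obtain ⟨s, hs, hsv, hsi, -⟩ := exists_fix_not_mem hE
  refine hnl s hs hsv fun g hg => ?_
  -- Since `s` fixes `i` and lies outside `Gv`, it corrects any element outside `Gv`: the orbit of
  -- `i` under `Ge ∩ Gv` is the same as under `Ge`. Transports of `g ∈ Gv` can thus be taken inside
  -- `Gv`.
  have horb : ∀ a ∈ Ge, ∃ c ∈ Ge, c ∈ Gv ∧ (a * c).right i = i := by
    intro a ha
    by_cases hav : a ∈ Gv
    · exact ⟨a⁻¹, Ge.inv_mem ha, Gv.inv_mem hav, by rw [mul_inv_cancel]; rfl⟩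
    · refine ⟨a⁻¹ * s, Ge.mul_mem (Ge.inv_mem ha) hs,
        hidx _ (Ge.inv_mem ha) _ hs (fun h => hav (by simpa using h)) hsv, ?_⟩
      rwa [mul_inv_cancel_left]
  rw [← h.transportSubgroup_self]
  refine ⟨hv hg, fun a ha b hb hab => ?_⟩
  obtain ⟨c, hc, hcv, hac⟩ := horb a ha
  obtain ⟨d, hd, hdv, hbd⟩ := horb b⁻¹ (Ge.inv_mem hb)
  have hdb : (d⁻¹ * b).right i = i := by
    have : d⁻¹ * b = (b⁻¹ * d)⁻¹ := by group
    rw [this]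
    exact right_inv_apply_of_right_apply hbd
  have heq : a * g * b = (a * c) * ((c⁻¹ * g * d) * (d⁻¹ * b)) := by group
  have hmid : (c⁻¹ * g * d).right i = i := by
    have : c⁻¹ * g * d = (a * c)⁻¹ * ((a * g * b) * (b⁻¹ * d)) := by group
    rw [this, right_mul_apply, right_mul_apply, hbd, hab]
    exact right_inv_apply_of_right_apply hac
  rw [heq, left_mul_of_right_apply hac, left_mul_of_right_apply hmid]
  refine Subgroup.mul_mem _ (mem_inducedGroup.2 ⟨_, Ge.mul_mem ha hc, hac, rfl⟩)
    (Subgroup.mul_mem _ (hle (mem_inducedGroup.2 ⟨_, ?_, hmid, rfl⟩))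
      (mem_inducedGroup.2 ⟨_, Ge.mul_mem (Ge.inv_mem hd) hb, hdb, rfl⟩))
  exact Gv.mul_mem (Gv.mul_mem (Gv.inv_mem hcv) hg) hdv

/-- If Inn(T) ≤ H, the part of the `i`-th factor inside `Gv` is normal in that factor. It contains
the nontrivial part coming from `E`, so it is everything. As `s` normalises this factor and swaps
the two ends, the factor fixes both ends, hence lies in `Ge`, contradicting `not_range_conj_le`. -/
theorem not_range_conj_le_vertex [IsSimpleGroup T] (h : IsPAStabilizer i G Ge)
    (hidx : ∀ a ∈ Ge, ∀ b ∈ Ge, a ∉ Gv → b ∉ Gv → a * b ∈ Gv)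
    (hvw : ∀ s ∈ Ge, s ∉ Gv → ∀ g ∈ Gv, s⁻¹ * g * s ∈ Gv → g ∈ Ge)
    (hE : ¬ inducedGroup i Ge ≤ inducedGroup i Gv) :
    ¬ (MulAut.conj : T →* MulAut T).range ≤ inducedGroup i Gv := by
  intro hle
  obtain ⟨s, hs, hsv, hsi, hsH⟩ := exists_fix_not_mem hE
  have hmem : ∀ t : T, MulAut.conj t ∈ inducedGroup i Ge → innSingle i t ∈ Gv := by
    intro t ht
    by_contra hcon
    -- If the element were outside `Gv`, its product with `s` would be in `Gv`, which puts `s.left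
    -- i` in `H` because Inn(T) ≤ H.
    have h1 := hidx s hs _ (h.innSingle_mem ht) hsv hcon
    have h2 : s.left i * MulAut.conj t ∈ inducedGroup i Gv :=
      mem_inducedGroup.2 ⟨_, h1, hsi, by rw [left_mul_of_right_apply hsi, innSingle_left]⟩
    exact hsH ((Subgroup.mul_mem_cancel_right _ (hle ⟨t, rfl⟩)).1 h2)
  let K : Subgroup T := Gv.comap
    ((SemidirectProduct.inl : (Fin k → MulAut T) →* AutWreath T k).comp
      ((MonoidHom.mulSingle (fun _ : Fin k => MulAut T) i).comp MulAut.conj))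
  have hK : ∀ t, t ∈ K ↔ innSingle i t ∈ Gv := fun t => Iff.rfl
  have hKn : K.Normal := by
    refine ⟨fun a ha t => ?_⟩
    obtain ⟨g, hg, hgi, hgt⟩ := mem_inducedGroup.1 (hle ⟨t, rfl⟩)
    rw [hK] at ha ⊢
    have h1 := conj_innSingle a hgi
    rw [hgt, MulAut.conj_apply] at h1
    rw [← h1]
    exact Gv.mul_mem (Gv.mul_mem hg ha) (Gv.inv_mem hg)
  rcases hKn.eq_bot_or_eq_top with hb | ht
  · obtain ⟨n, hn, hne, hn1⟩ := h.ne_one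
    obtain ⟨t, ht⟩ := (mem_innBase.1 hn).2 i
    have htE : MulAut.conj t ∈ inducedGroup i Ge := by
      rw [ht]
      exact mem_inducedGroup.2 ⟨n, hne, by rw [(mem_innBase.1 hn).1]; rfl, rfl⟩
    have : t ∈ K := (hK t).2 (hmem t htE)
    rw [hb, Subgroup.mem_bot] at this
    rw [← ht, this, map_one] at hn1
    exact hn1 rfl
  · have hall : ∀ t, innSingle i t ∈ Gv := fun t => (hK t).1 (by rw [ht]; trivial)
    refine h.not_range_conj_le ?_
    rintro _ ⟨t, rfl⟩
    refine mem_inducedGroup.2 ⟨innSingle i t, hvw s hs hsv _ (hall t) ?_, rfl, innSingle_left t⟩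
    have h1 := conj_innSingle t (right_inv_apply_of_right_apply hsi)
    rw [inv_inv] at h1
    rw [h1]
    exact hall _

end IsPAStabilizer

end AutWreath

/-! ### Edge-primitive graphs from group actions -/

section OrbitGraph

variable {B W : Type*} [Group B] [MulAction B W]

/-- The graph whose edges are the images of the pair `{x, y}`. -/
def orbitGraph (B : Type*) {W : Type*} [Group B] [MulAction B W] {x y : W} (hxy : x ≠ y) :
    SimpleGraph W where
  Adj a b := ∃ g : B, s(g • x, g • y) = s(a, b)
  symm := ⟨by
    rintro a b ⟨g, hg⟩
    exact ⟨g, hg.trans Sym2.eq_swap⟩⟩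
  loopless := ⟨by
    rintro a ⟨g, hg⟩
    rw [Sym2.eq_iff] at hg
    rcases hg with ⟨h1, h2⟩ | ⟨h1, h2⟩ <;>
    exact hxy (smul_left_cancel g (h1.trans h2.symm))⟩

variable {x y : W} (hxy : x ≠ y)

theorem orbitGraph_adj_smul (g : B) {a b : W} (h : (orbitGraph B hxy).Adj a b) :
    (orbitGraph B hxy).Adj (g • a) (g • b) := by
  obtain ⟨c, hc⟩ := h
  refine ⟨g * c, ?_⟩
  have := congrArg (Sym2.map (g • ·)) hc
  simpa [mul_smul] using this

theorem orbitGraph_adj : (orbitGraph B hxy).Adj x y := ⟨1, by simp⟩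

/-- The action on the graph `orbitGraph`. -/
def orbitGraphHom : B →* (orbitGraph B hxy ≃g orbitGraph B hxy) where
  toFun g := ⟨MulAction.toPerm g, by
    intro a b
    refine ⟨fun h => ?_, orbitGraph_adj_smul hxy g⟩
    simpa using orbitGraph_adj_smul hxy g⁻¹ h⟩
  map_one' := by
    ext a
    exact one_smul B a
  map_mul' g h := by
    ext a
    exact mul_smul g h a

theorem orbitGraphHom_apply (g : B) (a : W) : orbitGraphHom hxy g a = g • a := rfl

theorem mem_comap_edgeStab {E : Subgroup B} (hE : ∀ b, b ∈ E ↔ s(b • x, b • y) = s(x, y)) :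
    (edgeStab (orbitGraph B hxy) ⟨s(x, y), orbitGraph_adj hxy⟩).comap (orbitGraphHom hxy) = E := by
  ext b
  rw [hE]
  exact Subtype.ext_iff

theorem comap_vertexStab :
    (vertexStab (orbitGraph B hxy) x).comap (orbitGraphHom hxy) = MulAction.stabilizer B x :=
  Subgroup.ext fun _ => Iff.rfl

theorem orbitGraph_connected (hcover : ∀ w, w ∈ MulAction.orbit B x ∨ w ∈ MulAction.orbit B y)
    {E : Subgroup B} (hE : IsCoatom E) (hES : ∀ b, b ∈ E ↔ s(b • x, b • y) = s(x, y))
    (hconn : ¬ MulAction.stabilizer B x ≤ E ∨ ¬ MulAction.stabilizer B y ≤ E) :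
    (orbitGraph B hxy).Connected := by
  have hsmul : ∀ (g : B) {a b : W}, (orbitGraph B hxy).Reachable a b →
      (orbitGraph B hxy).Reachable (g • a) (g • b) := fun g a b h =>
    h.map (orbitGraphHom hxy g).toHom
  have hadj : ∀ g : B, (orbitGraph B hxy).Reachable (g • x) (g • y) := fun g =>
    hsmul g (orbitGraph_adj hxy).reachable
  -- The elements keeping `x` in its component form a subgroup containing `E` and both end
  -- stabilisers, hence everything by maximality of `E`.
  let K : Subgroup B :=
    { carrier := {b | (orbitGraph B hxy).Reachable x (b • x)}
      one_mem' := by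
        change (orbitGraph B hxy).Reachable x ((1 : B) • x)
        rw [one_smul]
      mul_mem' := by
        intro b c hb hc
        change (orbitGraph B hxy).Reachable x ((b * c) • x)
        rw [mul_smul]
        exact SimpleGraph.Reachable.trans hb (hsmul b hc)
      inv_mem' := by
        intro b hb
        have := hsmul b⁻¹ hb
        rw [inv_smul_smul] at this
        exact this.symm }
  have hK : ∀ b, (orbitGraph B hxy).Reachable x (b • x) → b ∈ K := fun b hb => hb
  have hEK : E ≤ K := by
    intro b hb
    have hb' := (hES b).1 hb
    rw [Sym2.eq_iff] at hb'
    apply hK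
    rcases hb' with ⟨h1, -⟩ | ⟨h1, -⟩
    · rw [h1]
    · rw [h1]
      exact (orbitGraph_adj hxy).reachable
  have hxK : MulAction.stabilizer B x ≤ K := fun b hb => hK b (by
    rw [MulAction.mem_stabilizer_iff.1 hb])
  have hyK : MulAction.stabilizer B y ≤ K := fun b hb => hK b (by
    have := hadj b
    rw [MulAction.mem_stabilizer_iff.1 hb] at this
    exact (orbitGraph_adj hxy).reachable.trans this.symm)
  have hKtop : K = ⊤ := by
    rcases eq_or_lt_of_le hEK with h | h
    · rw [h] at hconn
      exact absurd hconn (by simp [hxK, hyK])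
    · exact hE.2 K h
  have hall : ∀ w, (orbitGraph B hxy).Reachable x w := by
    intro w
    rcases hcover w with ⟨b, rfl⟩ | ⟨b, rfl⟩
    · have : b ∈ K := by rw [hKtop]; trivial
      exact this
    · have : b ∈ K := by rw [hKtop]; trivial
      exact SimpleGraph.Reachable.trans this (hadj b)
  have : Nonempty W := ⟨x⟩
  exact ⟨fun a b => (hall a).symm.trans (hall b)⟩

theorem orbitGraph_isEdgePrimitive {E : Subgroup B} (hE : IsCoatom E)
    (hES : ∀ b, b ∈ E ↔ s(b • x, b • y) = s(x, y)) :
    IsEdgePrimitive (orbitGraph B hxy) (orbitGraphHom (B := B) hxy).range := by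
  let Δ := orbitGraph B hxy
  let f : B →* edgeGroup Δ (orbitGraphHom (B := B) hxy).range :=
    ((edgeAction Δ).comp (orbitGraphHom hxy)).codRestrict _ fun b =>
      ⟨orbitGraphHom hxy b, ⟨b, rfl⟩, rfl⟩
  let _ : MulAction B Δ.edgeSet := MulAction.compHom _ f
  have hval : ∀ (b : B) (e : Δ.edgeSet), (b • e : Δ.edgeSet).1 = Sym2.map (b • ·) e.1 :=
    fun _ _ => rfl
  let e₀ : Δ.edgeSet := ⟨s(x, y), orbitGraph_adj hxy⟩
  have hstab : MulAction.stabilizer B e₀ = E := by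
    ext b
    rw [hES, MulAction.mem_stabilizer_iff, Subtype.ext_iff, hval]
    simp [e₀]
  have htrans : MulAction.IsPretransitive B Δ.edgeSet := by
    refine MulAction.IsPretransitive.of_orbit (x₀ := e₀) ?_
    rintro ⟨e, he⟩
    induction e with
    | _ a b =>
      obtain ⟨g, hg⟩ := he
      exact ⟨g, Subtype.ext hg⟩
  have hnt : Nontrivial Δ.edgeSet := by
    obtain ⟨b, hb⟩ : ∃ b, b ∉ E := by
      by_contra! hcon
      exact hE.1 ((Subgroup.eq_top_iff' E).2 hcon)
    refine ⟨b • e₀, e₀, fun h => hb ?_⟩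
    rw [← hstab]
    exact h
  have hprim : MulAction.IsPreprimitive B Δ.edgeSet := by
    rw [← MulAction.isCoatom_stabilizer_iff_preprimitive B e₀, hstab]
    exact hE
  let F : Δ.edgeSet →ₑ[f] Δ.edgeSet := ⟨id, fun _ _ => rfl⟩
  exact MulAction.IsPreprimitive.of_surjective (f := F) Function.surjective_id

/-- A faithful group action with a maximal pair stabiliser gives an edge-primitive graph. The
vertex set is replaced by a set in the lowest universe. -/
theorem exists_edgePrimitive_graph [Finite W] (hfaith : ∀ b : B, (∀ w : W, b • w = w) → b = 1)
    {x y : W} (hxy : x ≠ y) (hcover : ∀ w, w ∈ MulAction.orbit B x ∨ w ∈ MulAction.orbit B y)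
    {E : Subgroup B} (hE : IsCoatom E) (hES : ∀ b, b ∈ E ↔ s(b • x, b • y) = s(x, y))
    (hconn : ¬ MulAction.stabilizer B x ≤ E ∨ ¬ MulAction.stabilizer B y ≤ E) :
    ∃ (W' : Type) (_ : Finite W') (Δ : SimpleGraph W') (ψ : B →* (Δ ≃g Δ)),
      Function.Injective ψ ∧ Δ.Connected ∧ IsEdgePrimitive Δ ψ.range ∧
      ∃ (x' y' : W') (hxy' : Δ.Adj x' y'),
        (edgeStab Δ ⟨s(x', y'), hxy'⟩).comap ψ = E ∧
        (vertexStab Δ x').comap ψ = MulAction.stabilizer B x := by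
  obtain ⟨n, ⟨e⟩⟩ := Finite.exists_equiv_fin W
  let _ : MulAction B (Fin n) := e.symm.mulAction B
  have hsm : ∀ (b : B) (w : W), b • e w = e (b • w) := by
    intro b w
    rw [Equiv.smul_def]
    simp
  have hstab : ∀ w, MulAction.stabilizer B (e w) = MulAction.stabilizer B w := by
    intro w
    ext b
    rw [MulAction.mem_stabilizer_iff, MulAction.mem_stabilizer_iff, hsm, e.apply_eq_iff_eq]
  have hxy' : e x ≠ e y := fun h => hxy (e.injective h)
  have hES' : ∀ b, b ∈ E ↔ s(b • e x, b • e y) = s(e x, e y) := by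
    intro b
    simp only [hES, hsm, Sym2.eq_iff, e.apply_eq_iff_eq]
  have hcover' : ∀ w, w ∈ MulAction.orbit B (e x) ∨ w ∈ MulAction.orbit B (e y) := by
    intro w
    obtain ⟨w, rfl⟩ := e.surjective w
    rcases hcover w with ⟨b, rfl⟩ | ⟨b, rfl⟩
    · exact Or.inl ⟨b, hsm b x⟩
    · exact Or.inr ⟨b, hsm b y⟩
  refine ⟨Fin n, inferInstance, orbitGraph B hxy', orbitGraphHom hxy', ?_,
    orbitGraph_connected hxy' hcover' hE hES' (by rwa [hstab, hstab]),
    orbitGraph_isEdgePrimitive hxy' hE hES', e x, e y, orbitGraph_adj hxy',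
    mem_comap_edgeStab hxy' hES', ?_⟩
  · rw [injective_iff_map_eq_one]
    intro b hb
    refine hfaith b fun w => e.injective ?_
    rw [← hsm, ← orbitGraphHom_apply hxy', hb]
    rfl
  · rw [comap_vertexStab, hstab]

/-- The star with centre `none` and leaves B/E: an edge has the same stabiliser as its leaf.
Maximality leaves H = E, the stabiliser of a leaf, or H = B, that of the centre. -/
theorem exists_edgePrimitive_star [Finite B] {E : Subgroup B} (hE : IsCoatom E)
    (hcore : ∀ K : Subgroup B, K.Normal → K ≤ E → K = ⊥) {H : Subgroup B} (hH : E ≤ H) :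
    ∃ (W' : Type) (_ : Finite W') (Δ : SimpleGraph W') (ψ : B →* (Δ ≃g Δ)),
      Function.Injective ψ ∧ Δ.Connected ∧ IsEdgePrimitive Δ ψ.range ∧
      ∃ (x y : W') (hxy : Δ.Adj x y),
        (edgeStab Δ ⟨s(x, y), hxy⟩).comap ψ = E ∧ (vertexStab Δ x).comap ψ = H := by
  let o : Option (B ⧸ E) := some ((1 : B) : B ⧸ E)
  have hone : MulAction.stabilizer B o = E := by
    ext b
    rw [MulAction.mem_stabilizer_iff]
    simp only [o, Option.smul_some, Option.some_inj]
    rw [← MulAction.mem_stabilizer_iff, MulAction.stabilizer_quotient]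
  have hnone : MulAction.stabilizer B (none : Option (B ⧸ E)) = ⊤ := by
    ext b
    simp [MulAction.mem_stabilizer_iff]
  have hne : o ≠ none := by simp [o]
  have hfaith : ∀ b : B, (∀ w : Option (B ⧸ E), b • w = w) → b = 1 := by
    intro b hb
    have hker := hcore (MulAction.toPermHom B (Option (B ⧸ E))).ker inferInstance (by
      intro c hc
      rw [← hone, MulAction.mem_stabilizer_iff]
      exact DFunLike.congr_fun (MonoidHom.mem_ker.1 hc) o)
    rw [← Subgroup.mem_bot, ← hker, MonoidHom.mem_ker]
    exact Equiv.ext hb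
  have hcover : ∀ w : Option (B ⧸ E), w ∈ MulAction.orbit B o ∨
      w ∈ MulAction.orbit B (none : Option (B ⧸ E)) := by
    rintro (_ | w)
    · exact Or.inr (MulAction.mem_orbit_self _)
    · obtain ⟨b, rfl⟩ := QuotientGroup.mk_surjective w
      refine Or.inl ⟨b, ?_⟩
      simp [o]
  have hES : ∀ b : B, b ∈ E ↔ s(b • o, b • (none : Option (B ⧸ E))) = s(o, none) := by
    intro b
    have hb : b ∈ E ↔ b • o = o := by rw [← MulAction.mem_stabilizer_iff, hone]
    rw [hb]
    constructor
    · intro h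
      rw [h, Option.smul_none]
    · intro h
      rw [Option.smul_none, Sym2.eq_iff] at h
      rcases h with h | h
      · exact h.1
      · exact absurd h.2.symm hne
  have hnot : ¬ MulAction.stabilizer B (none : Option (B ⧸ E)) ≤ E := by
    rw [hnone, top_le_iff]
    exact hE.1
  rcases eq_or_lt_of_le hH with rfl | h
  · have := exists_edgePrimitive_graph hfaith hne hcover hE hES (Or.inr hnot)
    rwa [hone] at this
  · rw [hE.2 H h]
    have := exists_edgePrimitive_graph hfaith hne.symm (fun w => (hcover w).symm) hE
      (fun b => by rw [hES, Sym2.eq_swap, Sym2.eq_swap (a := o)]) (Or.inl hnot)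
    rwa [hnone] at this

/-- Since E ∩ H has index 2 in `E`, the group `E` preserves the pair {H, cH}; maximality makes it
the whole stabiliser unless `B` preserves the pair. -/
theorem exists_edgePrimitive_coset [Finite B] {E H : Subgroup B} (hE : IsCoatom E)
    (hcore : ∀ K : Subgroup B, K.Normal → K ≤ H → K = ⊥) (hEH : ¬ E ≤ H) (hHE : ¬ H ≤ E)
    (hidx : ∀ a ∈ E, ∀ b ∈ E, a ∉ H → b ∉ H → a * b ∈ H)
    (hcomm : ∃ a b : B, a * b ≠ b * a) :
    ∃ (W' : Type) (_ : Finite W') (Δ : SimpleGraph W') (ψ : B →* (Δ ≃g Δ)),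
      Function.Injective ψ ∧ Δ.Connected ∧ IsEdgePrimitive Δ ψ.range ∧
      ∃ (x y : W') (hxy : Δ.Adj x y),
        (edgeStab Δ ⟨s(x, y), hxy⟩).comap ψ = E ∧ (vertexStab Δ x).comap ψ = H := by
  obtain ⟨c, hcE, hcH⟩ := SetLike.not_le_iff_exists.1 hEH
  let x : B ⧸ H := ((1 : B) : B ⧸ H)
  have hx : MulAction.stabilizer B x = H := MulAction.stabilizer_quotient H
  have hxy : x ≠ c • x := by
    intro h
    exact hcH (by rw [← hx]; exact h.symm)
  have hmk : ∀ b : B, b • x = (b : B ⧸ H) := fun b => by simp [x]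
  have hfaith : ∀ b : B, (∀ w : B ⧸ H, b • w = w) → b = 1 := by
    intro b hb
    have hker := hcore (MulAction.toPermHom B (B ⧸ H)).ker inferInstance (by
      intro d hd
      rw [← hx, MulAction.mem_stabilizer_iff]
      exact DFunLike.congr_fun (MonoidHom.mem_ker.1 hd) x)
    rw [← Subgroup.mem_bot, ← hker, MonoidHom.mem_ker]
    exact Equiv.ext hb
  let S : Subgroup B :=
    (edgeStab (orbitGraph B hxy) ⟨s(x, c • x), orbitGraph_adj hxy⟩).comap (orbitGraphHom hxy)
  have hS : ∀ b, b ∈ S ↔ s(b • x, b • c • x) = s(x, c • x) :=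
    fun b => Subtype.ext_iff
  have hES : E ≤ S := by
    intro b hb
    rw [hS]
    have key : ∀ d ∈ E, d ∉ H → d • x = c • x := by
      intro d hd hdH
      rw [hmk, hmk]
      refine QuotientGroup.eq.2 (hidx _ (E.inv_mem hd) _ hcE (fun h => hdH ?_) hcH)
      simpa using h
    have key' : ∀ d ∈ H, d • x = x := by
      intro d hd
      rwa [← hx] at hd
    rw [← mul_smul]
    by_cases hbH : b ∈ H
    · have : b * c ∉ H := fun h => hcH ((H.mul_mem_cancel_left hbH).1 h)
      rw [key' b hbH, key _ (E.mul_mem hb hcE) this]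
    · rw [key b hb hbH, key' _ (hidx b hb c hcE hbH hcH), Sym2.eq_swap]
  -- Otherwise `H` has index 2 in `B`, so it is normal, so trivial; then all squares in `B` are
  -- trivial and `B` is abelian.
  have hSne : S ≠ ⊤ := by
    intro htop
    have hmem : ∀ b : B, b • x = x ∨ b • x = c • x := by
      intro b
      have hb : b ∈ S := by rw [htop]; trivial
      rw [hS, Sym2.eq_iff] at hb
      exact hb.imp And.left And.left
    have hindex : ∀ b : B, b ∉ H → b • x = c • x := fun b hb =>
      (hmem b).resolve_left fun h => hb (by rw [← hx]; exact h)
    have hmul : ∀ a b : B, a ∉ H → b ∉ H → a⁻¹ * b ∈ H := by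
      intro a b ha hb
      have := (hindex a ha).trans (hindex b hb).symm
      rw [hmk, hmk] at this
      exact QuotientGroup.eq.1 this
    have hnormal : H.Normal := by
      refine ⟨fun n hn g => ?_⟩
      by_cases hg : g ∈ H
      · exact H.mul_mem (H.mul_mem hg hn) (H.inv_mem hg)
      · have hg' : g⁻¹ ∉ H := fun h => hg (by simpa using h)
        have h1 : n⁻¹ * g⁻¹ ∉ H := fun h => hg' ((H.mul_mem_cancel_left (H.inv_mem hn)).1 h)
        have := hmul _ _ h1 hg'
        simpa using this
    have hbot := hcore H hnormal le_rfl
    have hsq : ∀ b : B, b * b = 1 := by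
      intro b
      by_cases hb : b ∈ H
      · rw [hbot, Subgroup.mem_bot] at hb
        simp [hb]
      · have := hmul b⁻¹ b (fun h => hb (by simpa using h)) hb
        rwa [hbot, Subgroup.mem_bot, inv_inv] at this
    obtain ⟨a, b, hab⟩ := hcomm
    refine hab ?_
    have hinv : ∀ d : B, d⁻¹ = d := fun d => inv_eq_of_mul_eq_one_right (hsq d)
    rw [← hinv (a * b), mul_inv_rev, hinv, hinv]
  have hSE : S = E := ((hE.le_iff).1 hES).resolve_left hSne
  have hcover : ∀ w : B ⧸ H, w ∈ MulAction.orbit B x ∨ w ∈ MulAction.orbit B (c • x) := by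
    intro w
    obtain ⟨b, rfl⟩ := QuotientGroup.mk_surjective w
    exact Or.inl ⟨b, hmk b⟩
  have := exists_edgePrimitive_graph hfaith hxy hcover hE
    (fun b => by rw [← hSE, hS]) (Or.inl (by rwa [hx]))
  rwa [hx] at this

end OrbitGraph

/-! ### Faithfulness of the action on edges -/

namespace SimpleGraph

variable {V : Type*} {Γ : SimpleGraph V}

theorem Connected.edge_eq_of_unique_neighbors (hΓ : Γ.Connected) {u u' : V}
    (h1 : ∀ z, Γ.Adj u z → z = u') (h2 : ∀ z, Γ.Adj u' z → z = u) (e : Γ.edgeSet) :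
    e.1 = s(u, u') := by
  have hall : ∀ a b : V, Γ.Walk a b → (a = u ∨ a = u') → (b = u ∨ b = u') := by
    intro a b p
    induction p with
    | nil => exact id
    | cons hadj _ ih =>
      rintro (rfl | rfl)
      · exact ih (Or.inr (h1 _ hadj))
      · exact ih (Or.inl (h2 _ hadj))
  obtain ⟨e, he⟩ := e
  induction e with
  | _ a b =>
    obtain ⟨p⟩ := hΓ.preconnected u a
    have hab : Γ.Adj a b := he
    rcases hall u a p (Or.inl rfl) with rfl | rfl
    · exact congrArg (fun z => s(a, z)) (h1 b hab)
    · exact (congrArg (fun z => s(a, z)) (h2 b hab)).trans Sym2.eq_swap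

/-- An automorphism that fixes every edge but moves `u` must flip each edge at `u`, so {u, f u} is a
connected component and the only edge. -/
theorem Connected.eq_one_of_edgeAction_eq_one (hΓ : Γ.Connected) [Nontrivial Γ.edgeSet]
    {f : Γ ≃g Γ} (hf : edgeAction Γ f = 1) : f = 1 := by
  have hfix : ∀ {a b : V}, Γ.Adj a b → s(f a, f b) = s(a, b) := fun {a b} h =>
    Subtype.ext_iff.1 (DFunLike.congr_fun hf (⟨s(a, b), h⟩ : Γ.edgeSet))
  have hV : Nontrivial V := by
    obtain ⟨⟨e, he⟩⟩ := (inferInstance : Nonempty Γ.edgeSet)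
    induction e with
    | _ a b => exact ⟨a, b, Γ.ne_of_adj he⟩
  ext u
  by_contra hu
  have hu' : f u ≠ u := hu
  have hnb : ∀ z, Γ.Adj u z → z = f u ∧ f z = u := by
    intro z hz
    have h := hfix hz
    rw [Sym2.eq_iff] at h
    rcases h with h | h
    · exact absurd h.1 hu'
    · exact ⟨h.1.symm, h.2⟩
  obtain ⟨z, hz⟩ : ∃ z, Γ.Adj u z := by
    obtain ⟨z, hz⟩ := exists_ne u
    obtain ⟨p⟩ := hΓ.preconnected u z
    cases p with
    | nil => exact absurd rfl hz
    | cons h _ => exact ⟨_, h⟩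
  obtain ⟨rfl, hffu⟩ := hnb z hz
  have hnb' : ∀ z, Γ.Adj (f u) z → z = u := by
    intro z hz'
    have h := hfix hz'
    rw [Sym2.eq_iff, hffu] at h
    rcases h with h | h
    · exact absurd h.1.symm hu'
    · exact h.1.symm
  have heq := hΓ.edge_eq_of_unique_neighbors (fun z hz => (hnb z hz).1) hnb'
  obtain ⟨e, e', hne⟩ := exists_pair_ne Γ.edgeSet
  exact hne (Subtype.ext ((heq e).trans (heq e').symm))

end SimpleGraph

/-! ### Socles, and the passage from type PA to the wreath product -/

theorem IsMinimalNormal.comap {G P : Type*} [Group G] [Group P] (e : G ≃* P) {N : Subgroup P}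
    (hN : IsMinimalNormal N) : IsMinimalNormal (N.comap e.toMonoidHom) where
  normal := hN.normal.comap _
  ne_bot := by
    intro h
    refine hN.ne_bot ((Subgroup.eq_bot_iff_forall _).2 fun x hx => ?_)
    have : e.symm x ∈ N.comap e.toMonoidHom := by simpa using hx
    rw [h, Subgroup.mem_bot] at this
    simpa using this
  minimal := by
    intro M hM hle
    have hmap : (M.map e.toMonoidHom).comap e.toMonoidHom = M :=
      Subgroup.comap_map_eq_self_of_injective e.injective M
    rcases hN.minimal (M.map e.toMonoidHom) (hM.map _ e.surjective)
      (Subgroup.map_le_iff_le_comap.2 hle) with h | h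
    · exact Or.inl ((Subgroup.map_eq_bot_iff_of_injective _ e.injective).1 h)
    · exact Or.inr (by rw [← hmap, h])

theorem socle_eq_comap {G P : Type*} [Group G] [Group P] (e : G ≃* P) {N : Subgroup P}
    (hN : IsMinimalNormal N) (huniq : ∀ M : Subgroup P, IsMinimalNormal M → M = N) :
    socle G = N.comap e.toMonoidHom := by
  have : {M : Subgroup G | IsMinimalNormal M} = {N.comap e.toMonoidHom} := by
    ext M
    refine ⟨fun hM => ?_, fun hM => ?_⟩
    · have h := huniq _ (IsMinimalNormal.comap e.symm hM)
      rw [Set.mem_singleton_iff, ← h]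
      ext x
      simp
    · rw [Set.mem_singleton_iff.1 hM]
      exact hN.comap e
  rw [socle, this, sSup_singleton]

namespace AutWreath

variable {T : Type*} [Group T] {k : ℕ}

theorem innBase_le_coordStab (i : Fin k) : innBase T k ≤ coordStab T k i := by
  intro x hx
  change x.right i = i
  rw [(mem_innBase.1 hx).1]
  rfl

/-- The projection of `Inn(T) ^ k` to the coordinate `i`. -/
def innCoord (T : Type*) [Group T] {k : ℕ} (i : Fin k) :
    innBase T k →* (MulAut.conj : T →* MulAut T).range :=
  ((coordProj T k i).comp (Subgroup.inclusion (innBase_le_coordStab i))).codRestrict _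
    fun x => (mem_innBase.1 x.2).2 i

end AutWreath

theorem MulAut.isSimpleGroup_range_conj {T : Type*} [Group T] [IsSimpleGroup T]
    (hT : ∃ a b : T, a * b ≠ b * a) :
    IsSimpleGroup (MulAut.conj : T →* MulAut T).range := by
  obtain ⟨t, ht⟩ := exists_ne (1 : T)
  have : Nontrivial (MulAut.conj : T →* MulAut T).range :=
    ⟨⟨MulAut.conj t, t, rfl⟩, 1, fun h =>
      ht (MulAut.conj_eq_one_of_simple hT (Subtype.ext_iff.1 h))⟩
  exact IsSimpleGroup.isSimpleGroup_of_surjective (MulAut.conj : T →* MulAut T).rangeRestrict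
    (MonoidHom.rangeRestrict_surjective _)

theorem MulAut.conj_injective_of_simple {T : Type*} [Group T] [IsSimpleGroup T]
    (hT : ∃ a b : T, a * b ≠ b * a) : Function.Injective (MulAut.conj : T →* MulAut T) :=
  (injective_iff_map_eq_one _).2 fun _ h => MulAut.conj_eq_one_of_simple hT h

theorem MulAut.exists_mul_ne_mul_range_conj {T : Type*} [Group T] [IsSimpleGroup T]
    (hT : ∃ a b : T, a * b ≠ b * a) :
    ∃ a b : (MulAut.conj : T →* MulAut T).range, a * b ≠ b * a := by
  have hinj := MulAut.conj_injective_of_simple hT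
  obtain ⟨a, b, hab⟩ := hT
  refine ⟨⟨_, a, rfl⟩, ⟨_, b, rfl⟩, fun h => hab (hinj ?_)⟩
  have := Subtype.ext_iff.1 h
  simpa using this

/-- Type PA in terms of the maximal subgroup `Ge` of a subgroup of the wreath product. -/
theorem IsTypePA.isPAStabilizer {T : Type*} [Group T] [IsSimpleGroup T]
    (hT : ∃ a b : T, a * b ≠ b * a) {k : ℕ} {Ω : Type*} [Nontrivial Ω]
    {P : Subgroup (Equiv.Perm Ω)} (hPA : IsTypePA T k P) (hP : MulAction.IsPreprimitive P Ω)
    {G : Type*} [Group G] (e : G ≃* P) (φ : G →* AutWreath T k)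
    (hφ : Function.Injective φ) (hsoc : (socle G).map φ = innBase T k) (i : Fin k) (ω : Ω) {Ge : Subgroup G}
    (hGe : Ge = (MulAction.stabilizer P ω).comap e.toMonoidHom) :
    AutWreath.IsPAStabilizer i φ.range (Ge.map φ) := by
  obtain ⟨N, hN, huniq, hst⟩ := hPA.socle_stabilizer
  obtain ⟨f, R, hbot, htop, hR⟩ := hst ω
  have hsocle := socle_eq_comap e hN huniq
  have hco : IsCoatom Ge := by
    rw [hGe]
    exact (Subgroup.isCoatom_comap e).2
      ((MulAction.isCoatom_stabilizer_iff_preprimitive P ω).2 hP)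
  have hsocmem : ∀ g : G, g ∈ socle G ↔ e g ∈ N := fun g => by rw [hsocle]; rfl
  let q : N →* innBase T k :=
    ((φ.comp e.symm.toMonoidHom).comp N.subtype).codRestrict _ fun n => by
      rw [← hsoc]
      exact ⟨e.symm n, (hsocmem _).2 (by simp), rfl⟩
  have hq : ∀ n : N, (q n : AutWreath T k) = φ (e.symm n) := fun _ => rfl
  have hqsurj : ∀ x ∈ innBase T k, ∃ n : N, (q n : AutWreath T k) = x := by
    intro x hx
    rw [← hsoc] at hx
    obtain ⟨g, hg, rfl⟩ := hx
    exact ⟨⟨e g, (hsocmem g).1 hg⟩, by rw [hq]; simp⟩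
  -- The identification `f` supplied by type PA depends on the point and need not match the wreath
  -- coordinates. Factoring `p` through a coordinate `j` of `f` carries the properties of `R` over
  -- to the coordinate `i`.
  let p : (Fin k → T) →* (MulAut.conj : T →* MulAut T).range :=
    (AutWreath.innCoord T i).comp (q.comp f.symm.toMonoidHom)
  have hp : ∀ n : N, (p (f n) : MulAut T) = (φ (e.symm n)).left i := by
    intro n
    change (φ (e.symm (f.symm (f n)))).left i = _
    rw [f.symm_apply_apply]
  have hpsurj : Function.Surjective p := by
    rintro ⟨_, t, rfl⟩
    obtain ⟨n, hn⟩ := hqsurj _ (AutWreath.innSingle_mem (i := i) t)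
    refine ⟨f n, Subtype.ext ?_⟩
    rw [hp, ← hq, hn, AutWreath.innSingle_left]
  have := MulAut.isSimpleGroup_range_conj hT
  obtain ⟨j, θ, hθi, hθs, hθ⟩ :=
    MonoidHom.exists_eq_comp_eval (MulAut.exists_mul_ne_mul_range_conj hT) p hpsurj
  have hstab : ∀ n : N, n ∈ MulAction.stabilizer N ω ↔ e.symm n ∈ Ge := by
    intro n
    rw [hGe, Subgroup.mem_comap]
    change _ ↔ e (e.symm n) ∈ MulAction.stabilizer P ω
    rw [e.apply_symm_apply]
    exact Iff.rfl
  have hmemR : ∀ n : N, e.symm n ∈ Ge → f n j ∈ R := fun n hn => by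
    rw [← hR j]
    exact ⟨f n, ⟨n, (hstab n).2 hn, rfl⟩, rfl⟩
  refine ⟨?_, ?_, ?_, ?_, ?_⟩
  · rw [← hsoc]
    exact Subgroup.map_le_range φ _
  · exact Subgroup.map_le_range φ _
  · intro X hX hXG
    have hle : Ge ≤ X.comap φ := Subgroup.map_le_iff_le_comap.1 hX
    have hXe : (X.comap φ).map φ = X := Subgroup.map_comap_eq_self hXG
    rcases hco.le_iff.1 hle with h | h
    · exact Or.inr (by rw [← hXe, h, MonoidHom.range_eq_map])
    · exact Or.inl (by rw [← hXe, h])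
  · obtain ⟨r, hr, hr1⟩ := (Subgroup.bot_or_exists_ne_one R).resolve_left hbot
    rw [← hR j] at hr
    obtain ⟨_, ⟨n, hn, rfl⟩, rfl⟩ := hr
    refine ⟨φ (e.symm n), (q n).2, ⟨_, (hstab n).1 hn, rfl⟩, fun h1 => hr1 (hθi ?_)⟩
    rw [map_one]
    refine Subtype.ext ?_
    rw [← hp, hθ] at h1
    exact h1
  · obtain ⟨r, hr⟩ : ∃ r, r ∉ R := by
      by_contra! hcon
      exact htop ((Subgroup.eq_top_iff' R).2 hcon)
    obtain ⟨t, ht⟩ := (θ r).2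
    refine ⟨t, fun x hx hxe hxt => hr ?_⟩
    obtain ⟨g, hg, rfl⟩ := hxe
    rw [← hsoc] at hx
    obtain ⟨g', hg', heq⟩ := hx
    rw [hφ heq] at hg'
    have hes : e.symm ((⟨e g, (hsocmem g).1 hg'⟩ : N) : P) = g := e.symm_apply_apply g
    have hmem := hmemR ⟨e g, (hsocmem g).1 hg'⟩ (by rw [hes]; exact hg)
    have hpn := hp ⟨e g, (hsocmem g).1 hg'⟩
    rw [hes, hxt, ht, hθ] at hpn
    rwa [hθi (Subtype.ext hpn)] at hmem

theorem IsTypePA.nontrivial {T : Type*} [Group T] {k : ℕ} {Ω : Type*}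
    {P : Subgroup (Equiv.Perm Ω)} (hPA : IsTypePA T k P) : Nontrivial Ω := by
  obtain ⟨N, hN, -, -⟩ := hPA.socle_stabilizer
  by_contra hcon
  rw [not_nontrivial_iff_subsingleton] at hcon
  exact hN.ne_bot (Subsingleton.elim _ _)

/-! ### Stabilisers of vertices and edges in Γ -/

section EdgeGroup

variable {V : Type*} {Γ : SimpleGraph V}

/-- The action on the edges as an isomorphism onto the group induced on the edges. -/
noncomputable def edgeGroupEquiv (hΓ : Γ.Connected) [Nontrivial Γ.edgeSet]
    (G : Subgroup (Γ ≃g Γ)) : G ≃* edgeGroup Γ G :=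
  Subgroup.equivMapOfInjective G (edgeAction Γ)
    ((injective_iff_map_eq_one _).2 fun _ h => hΓ.eq_one_of_edgeAction_eq_one h)

theorem mem_edgeStab {v w : V} {hvw : Γ.Adj v w} {f : Γ ≃g Γ} :
    f ∈ edgeStab Γ ⟨s(v, w), hvw⟩ ↔ (f v = v ∧ f w = w) ∨ (f v = w ∧ f w = v) := by
  rw [← Sym2.eq_iff]
  exact Subtype.ext_iff

theorem swap_of_not_fix {v w : V} {hvw : Γ.Adj v w} {f : Γ ≃g Γ}
    (hf : f ∈ edgeStab Γ ⟨s(v, w), hvw⟩) (hv : f ∉ vertexStab Γ v) : f v = w ∧ f w = v :=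
  (mem_edgeStab.1 hf).resolve_left fun h => hv h.1

/-- If the stabiliser of `v` fixed the edge, it would fix `w`. By edge-transitivity and the flip
`f`, every edge at `v` is the image of {v, w} under an element fixing `v`, so Γ would be a single
edge. -/
theorem not_vertexStab_le_edgeStab (hΓ : Γ.Connected) [Nontrivial Γ.edgeSet]
    {G : Subgroup (Γ ≃g Γ)} (hG : IsEdgePrimitive Γ G) {v w : V} {hvw : Γ.Adj v w}
    {f : Γ ≃g Γ} (hfG : f ∈ G) (hf : f v = w ∧ f w = v) :
    ¬ (vertexStab Γ v).subgroupOf G ≤ (edgeStab Γ ⟨s(v, w), hvw⟩).subgroupOf G := by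
  intro hle
  have hle' : ∀ g ∈ G, g v = v → g w = w := by
    intro g hg hgv
    have := hle (x := ⟨g, hg⟩) hgv
    rcases mem_edgeStab.1 this with h | h
    · exact h.2
    · exact h.2.trans (hgv.symm.trans h.1)
  have h1 : ∀ z, Γ.Adj v z → z = w := by
    intro z hz
    have := hG.toIsPretransitive
    obtain ⟨⟨_, g, hg, rfl⟩, hgz⟩ := MulAction.exists_smul_eq (edgeGroup Γ G)
      (⟨s(v, w), hvw⟩ : Γ.edgeSet) ⟨s(v, z), hz⟩
    have h : s(g v, g w) = s(v, z) := Subtype.ext_iff.1 hgz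
    rw [Sym2.eq_iff] at h
    rcases h with h | h
    · rw [← h.2, hle' g hg h.1]
    · have hfix : (g * f) v = v := by
        change g (f v) = v
        rw [hf.1, h.2]
      rw [← hle' (g * f) (G.mul_mem hg hfG) hfix]
      change z = g (f w)
      rw [hf.2, h.1]
  have h2 : ∀ z, Γ.Adj w z → z = v := by
    intro z hz
    have hadj : Γ.Adj v (f z) := by
      rw [← hf.2]
      exact f.map_adj_iff.2 hz
    have := h1 _ hadj
    rw [← hf.1] at this
    exact f.injective this
  have heq := hΓ.edge_eq_of_unique_neighbors h1 h2
  obtain ⟨e, e', hne⟩ := exists_pair_ne Γ.edgeSet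
  exact hne (Subtype.ext ((heq e).trans (heq e').symm))

end EdgeGroup

/-! ### Passage to subgroups of `B` and conclusion -/

/-- Maximality of `E` in `B` as a statement on the lattice of subgroups of `B`. -/
theorem Subgroup.isCoatom_subgroupOf {A : Type*} [Group A] {E B : Subgroup A} (hEB : E ≤ B)
    (hne : ¬ B ≤ E) (hmax : ∀ L, E ≤ L → L ≤ B → L = E ∨ L = B) : IsCoatom (E.subgroupOf B) := by
  refine ⟨fun h => hne (Subgroup.subgroupOf_eq_top.1 h), fun X hX => ?_⟩
  have hXX : (X.map B.subtype).subgroupOf B = X :=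
    Subgroup.comap_map_eq_self_of_injective B.subtype_injective X
  have hEX : E ≤ X.map B.subtype := fun x hx => ⟨⟨x, hEB hx⟩, hX.le hx, rfl⟩
  rcases hmax _ hEX (Subgroup.map_subtype_le X) with h | h
  · rw [h] at hXX
    exact absurd hXX hX.ne
  · rw [← hXX, h, Subgroup.subgroupOf_self]

theorem MulAut.eq_bot_of_normal_of_le {T : Type*} [Group T] [IsSimpleGroup T]
    {B H : Subgroup (MulAut T)} (hB : (MulAut.conj : T →* MulAut T).range ≤ B)
    (hH : ¬ (MulAut.conj : T →* MulAut T).range ≤ H) (K : Subgroup B) (hK : K.Normal)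
    (hKH : K ≤ H.subgroupOf B) : K = ⊥ := by
  refine (Subgroup.eq_bot_iff_forall _).2 fun x hx => Subtype.ext ?_
  refine MulAut.eq_one_of_normalized (K.map B.subtype) ?_ ?_ ⟨x, hx, rfl⟩
  · rintro t _ ⟨y, hy, rfl⟩
    exact ⟨_, hK.conj_mem y hy ⟨_, hB ⟨t, rfl⟩⟩, rfl⟩
  · intro h
    refine hH (h.trans ?_)
    rintro _ ⟨y, hy, rfl⟩
    exact hKH hy

theorem proposition6
    {V : Type*} [Finite V] (Γ : SimpleGraph V) (hΓ : Γ.Connected)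
    (G : Subgroup (Γ ≃g Γ)) (hG : IsEdgePrimitive Γ G)
    {T : Type*} [Group T] [Finite T] [IsSimpleGroup T] (hT : ∃ a b : T, a * b ≠ b * a)
    {k : ℕ} (hPA : IsTypePA T k (edgeGroup Γ G))
    (φ : G →* AutWreath T k) (hφ : Function.Injective φ)
    (hsoc : (socle G).map φ = innBase T k)
    (i : Fin k) (v w : V) (hvw : Γ.Adj v w)
    (B E H : Subgroup (MulAut T))
    (hB : B = inducedGroup i φ.range)
    (hE : E = inducedGroup i (((edgeStab Γ ⟨s(v, w), hvw⟩).subgroupOf G).map φ))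
    (hH : H = inducedGroup i (((vertexStab Γ v).subgroupOf G).map φ)) :
    ∃ (W : Type) (_ : Finite W) (Δ : SimpleGraph W) (ψ : B →* (Δ ≃g Δ)),
      Function.Injective ψ ∧ Δ.Connected ∧ IsEdgePrimitive Δ ψ.range ∧
      ∃ (x y : W) (hxy : Δ.Adj x y),
        (edgeStab Δ ⟨s(x, y), hxy⟩).comap ψ = E.subgroupOf B ∧
        (vertexStab Δ x).comap ψ = H.subgroupOf B := by
  have hnt : Nontrivial Γ.edgeSet := hPA.nontrivial
  set Ge := (edgeStab Γ ⟨s(v, w), hvw⟩).subgroupOf G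
  set Gv := (vertexStab Γ v).subgroupOf G
  have hst : AutWreath.IsPAStabilizer i φ.range (Ge.map φ) :=
    hPA.isPAStabilizer hT hG (edgeGroupEquiv hΓ G) φ hφ hsoc i ⟨s(v, w), hvw⟩ rfl
  have hmapv : ∀ {g : G}, φ g ∉ Gv.map φ → (g : Γ ≃g Γ) ∉ vertexStab Γ v :=
    fun {g} h hg => h ⟨g, hg, rfl⟩
  have hidx : ∀ a ∈ Ge.map φ, ∀ b ∈ Ge.map φ, a ∉ Gv.map φ → b ∉ Gv.map φ →
      a * b ∈ Gv.map φ := by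
    rintro _ ⟨a, ha, rfl⟩ _ ⟨b, hb, rfl⟩ hav hbv
    rw [← map_mul]
    refine ⟨a * b, ?_, rfl⟩
    change (a : Γ ≃g Γ) ((b : Γ ≃g Γ) v) = v
    have hbw : (b : Γ ≃g Γ) v = w := (swap_of_not_fix hb (hmapv hbv)).1
    rw [hbw]
    exact (swap_of_not_fix ha (hmapv hav)).2
  have hfix : ∀ s ∈ Ge.map φ, s ∉ Gv.map φ → ∀ g ∈ Gv.map φ, s⁻¹ * g * s ∈ Gv.map φ →
      g ∈ Ge.map φ := by
    rintro _ ⟨s, hs, rfl⟩ hsv _ ⟨g, hg, rfl⟩ hgs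
    have hsv1 : (s : Γ ≃g Γ) v = w := (swap_of_not_fix hs (hmapv hsv)).1
    rw [← map_inv, ← map_mul, ← map_mul] at hgs
    obtain ⟨c, hc, hcs⟩ := hgs
    rw [hφ hcs] at hc
    have hc' : ((s⁻¹ * g * s : G) : Γ ≃g Γ) v = v := hc
    have hgw : (g : Γ ≃g Γ) w = w := by
      have h1 : ((s * (s⁻¹ * g * s) : G) : Γ ≃g Γ) v = w := by
        change (s : Γ ≃g Γ) (((s⁻¹ * g * s : G) : Γ ≃g Γ) v) = w
        rw [hc', hsv1]
      have h2 : s * (s⁻¹ * g * s) = g * s := by group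
      rw [h2] at h1
      change (g : Γ ≃g Γ) ((s : Γ ≃g Γ) v) = w at h1
      rwa [hsv1] at h1
    exact ⟨g, mem_edgeStab.2 (Or.inl ⟨hg, hgw⟩), rfl⟩
  have hnl : ∀ s ∈ Ge.map φ, s ∉ Gv.map φ → ¬ Gv.map φ ≤ Ge.map φ := by
    rintro _ ⟨s, hs, rfl⟩ hsv hle
    refine not_vertexStab_le_edgeStab (hvw := hvw) hΓ hG s.2 (swap_of_not_fix hs (hmapv hsv)) ?_
    exact (Subgroup.map_le_map_iff_of_injective hφ).1 hle
  have hInnB : (MulAut.conj : T →* MulAut T).range ≤ B := hB ▸ hst.range_conj_le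
  have hInnE : ¬ (MulAut.conj : T →* MulAut T).range ≤ E := hE ▸ hst.not_range_conj_le
  have hEB : E ≤ B := by
    rw [hE, hB]
    exact AutWreath.inducedGroup_mono hst.le
  have hHB : H ≤ B := by
    rw [hH, hB]
    exact AutWreath.inducedGroup_mono (Subgroup.map_le_range φ _)
  have hco : IsCoatom (E.subgroupOf B) := by
    refine Subgroup.isCoatom_subgroupOf hEB (fun h => hInnE (hInnB.trans h)) ?_
    rw [hE, hB]
    exact hst.eq_or_eq_of_le
  have : Finite (MulAut T) := Finite.of_injective (fun σ : MulAut T => (σ : T → T))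
    DFunLike.coe_injective
  -- This separates the star from the coset graph; only in the second case is there an element
  -- fixing `i` that flips the edge and stays outside `H` after projection.
  by_cases hEH : E ≤ H
  · exact exists_edgePrimitive_star hco (MulAut.eq_bot_of_normal_of_le hInnB hInnE)
      (fun x hx => hEH hx)
  · have hEH' := hEH
    rw [hE, hH] at hEH'
    have hHE : ¬ H ≤ E := by
      rw [hE, hH]
      exact hst.not_induced_le (Subgroup.map_le_range φ _) hidx hnl hEH'
    have hInnH : ¬ (MulAut.conj : T →* MulAut T).range ≤ H := by
      rw [hH]
      exact hst.not_range_conj_le_vertex hidx hfix hEH'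
    refine exists_edgePrimitive_coset hco (MulAut.eq_bot_of_normal_of_le hInnB hInnH)
      (fun h => hEH fun x hx => h (x := ⟨x, hEB hx⟩) hx)
      (fun h => hHE fun x hx => h (x := ⟨x, hHB hx⟩) hx) ?_ ?_
    · intro a ha b hb hav hbv
      rw [Subgroup.mem_subgroupOf] at *
      rw [hH] at *
      rw [hE] at ha hb
      exact AutWreath.IsPAStabilizer.mul_mem_of_not_mem hidx ha hb hav hbv
    · obtain ⟨⟨a, ha⟩, ⟨b, hb⟩, hab⟩ := MulAut.exists_mul_ne_mul_range_conj hT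
      exact ⟨⟨a, hInnB ha⟩, ⟨b, hInnB hb⟩, fun h => hab (Subtype.ext (Subtype.ext_iff.1 h :))⟩
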